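/- Let $A$ be an $n\times n$ complex matrix. For $c=(c_1,\dots,c_n)\in\mathbb{R}^n$ let $$W_c(A)=\Big\{\sum_{j=1}^n c_j\,x_j^*Ax_j \;:\; x_1,\dots,x_n\in\mathbb{C}^n \text{ are orthonormal}\Big\}$$ denote the $c$-numerical range of $A$. Suppose that for every $c\in\mathbb{R}^n$ the set $W_c(A)$ is a circular disc centred at $0$, that is, $W_c(A)=\{z\in\mathbb{C} : |z|\le r\}$ for some real $r\ge 0$ (depending on $c$; the one-point set $\{0\}$ counts as the disc of radius $0$). Then $A$ is nilpotent. -/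

import Mathlib

open scoped Matrix

/-- The `c`-numerical range `W_c(A)`: all the sums `∑ j, c j * (x j)ᴴ A (x j)` over orthonormal
families `x 0, …, x (n-1)` in `ℂⁿ` with its standard inner product. -/
def cNumericalRange {n : ℕ} (c : Fin n → ℝ) (A : Matrix (Fin n) (Fin n) ℂ) : Set ℂ :=
  {z : ℂ | ∃ x : Fin n → EuclideanSpace ℂ (Fin n), Orthonormal ℂ x ∧
    z = ∑ j : Fin n, (c j : ℂ) * (star (x j).ofLp ⬝ᵥ (A *ᵥ (x j).ofLp))}

/-- A circular disc centred at `0` in the complex plane: a closed disc of radius `r ≥ 0`. The one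
point set `{0}` is the disc of radius `0`. -/
def IsCircularDiscAtZero (S : Set ℂ) : Prop :=
  ∃ r : ℝ, 0 ≤ r ∧ S = Metric.closedBall (0 : ℂ) r

open Matrix Polynomial
open scoped ComplexOrder

/-! For `|z| = 1` put `H_z = zA + z̄Aᴴ`. With `c` the spectrum of `H_z`, `W_c(A)` is the set of `tr
(MA)` over the unitary conjugates `M` of `H_z`. Rotation invariance of the disc gives, for any `|w|
= 1`, an `M` with `tr (M H_w) = tr (H_z²)`. Exchanging `z` and `w`, equality in Cauchy-Schwarz makes
`H_z` and `H_w` unitarily similar, so the characteristic polynomial of `H_z` does not depend on `z`.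
Extending this identity from the circle to all of `ℂ` and evaluating at `0` forces `det (s - A) = s
^ n`; Cayley-Hamilton concludes. -/

/-- The points of `W_c(A)` are the traces `tr (diag c · Uᴴ A U)` with `U` unitary. -/
lemma mem_cNumericalRange_iff {n : ℕ} (c : Fin n → ℝ) (A : Matrix (Fin n) (Fin n) ℂ) (z : ℂ) :
    z ∈ cNumericalRange c A ↔ ∃ U ∈ unitaryGroup (Fin n) ℂ,
      z = trace (diagonal (fun j => (c j : ℂ)) * (star U * A * U)) := by
  have key (x : Fin n → EuclideanSpace ℂ (Fin n)) (U : Matrix (Fin n) (Fin n) ℂ)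
      (hU : ∀ i j, U i j = (x j).ofLp i) :
      (Orthonormal ℂ x ↔ U ∈ unitaryGroup (Fin n) ℂ) ∧
      ∑ j : Fin n, (c j : ℂ) * (star (x j).ofLp ⬝ᵥ (A *ᵥ (x j).ofLp)) =
        trace (diagonal (fun j => (c j : ℂ)) * (star U * A * U)) := by
    constructor
    · rw [mem_unitaryGroup_iff', orthonormal_iff_ite, ← Matrix.ext_iff]
      refine forall_congr' fun i => forall_congr' fun j => ?_
      simp [Matrix.mul_apply, Matrix.one_apply, hU, PiLp.inner_apply, star_eq_conjTranspose,
        mul_comm]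
    · simp only [trace, diag_apply, diagonal_mul]
      refine Finset.sum_congr rfl fun j _ => ?_
      congr 1
      rw [Matrix.mul_assoc, Matrix.mul_apply]
      refine Finset.sum_congr rfl fun i _ => ?_
      simp [Matrix.mul_apply, mulVec, dotProduct, hU]
  constructor
  · rintro ⟨x, hx, rfl⟩
    obtain ⟨h1, h2⟩ := key x (of fun i j => (x j).ofLp i) fun _ _ => rfl
    exact ⟨_, h1.1 hx, h2⟩
  · rintro ⟨U, hU, rfl⟩
    obtain ⟨h1, h2⟩ := key (fun j => WithLp.toLp 2 fun i => U i j) U fun _ _ => rfl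
    exact ⟨_, h1.2 hU, h2.symm⟩

/-- Two Hermitian matrices `P`, `Q` are unitarily similar if `tr (P²)` is attained by pairing a
unitary conjugate of `P` with `Q`, and `tr (Q²)` by pairing one of `Q` with `P`: these are equality
cases of the Cauchy-Schwarz inequality. -/
lemma charpoly_eq_of_trace_conj_mul_eq {ι : Type*} [Fintype ι] [DecidableEq ι]
    {P Q U V : Matrix ι ι ℂ} (hP : P.IsHermitian) (hQ : Q.IsHermitian)
    (hU : U ∈ unitaryGroup ι ℂ) (hV : V ∈ unitaryGroup ι ℂ)
    (hPQ : trace (U * P * star U * Q) = trace (P * P))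
    (hQP : trace (V * Q * star V * P) = trace (Q * Q)) :
    P.charpoly = Q.charpoly := by
  have expand {P Q U : Matrix ι ι ℂ} (hP : P.IsHermitian) (hQ : Q.IsHermitian)
      (hU : U ∈ unitaryGroup ι ℂ) (hPQ : trace (U * P * star U * Q) = trace (P * P)) :
      trace ((U * P * star U - Q)ᴴ * (U * P * star U - Q)) = trace (Q * Q) - trace (P * P) := by
    have hM : (U * P * star U - Q)ᴴ = U * P * star U - Q := by
      simp [star_eq_conjTranspose, hP.eq, hQ.eq, Matrix.mul_assoc]
    have hMM : trace (U * P * star U * (U * P * star U)) = trace (P * P) := by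
      have : U * P * star U * (U * P * star U) = U * (P * P) * star U := by
        calc _ = U * P * (star U * U) * P * star U := by simp only [Matrix.mul_assoc]
          _ = _ := by rw [mem_unitaryGroup_iff'.1 hU]; simp [Matrix.mul_assoc]
      rw [this, Matrix.trace_mul_comm, ← Matrix.mul_assoc, mem_unitaryGroup_iff'.1 hU,
        Matrix.one_mul]
    rw [hM, sub_mul, mul_sub, mul_sub, trace_sub, trace_sub, trace_sub,
      Matrix.trace_mul_comm Q (U * P * star U), hPQ, hMM]
    ring
  have nonneg (M : Matrix ι ι ℂ) : 0 ≤ trace (Mᴴ * M) :=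
    (posSemidef_conjTranspose_mul_self M).trace_nonneg
  have h1 := expand hP hQ hU hPQ
  have h2 := expand hQ hP hV hQP
  have hle := nonneg (U * P * star U - Q)
  have hge := nonneg (V * Q * star V - P)
  rw [h1, sub_nonneg] at hle
  rw [h2, sub_nonneg] at hge
  -- The two squared Frobenius distances are opposite numbers, both nonnegative, hence zero.
  rw [le_antisymm hge hle, sub_self, trace_conjTranspose_mul_self_eq_zero_iff, sub_eq_zero] at h1
  rw [← h1, Matrix.mul_assoc, charpoly_mul_comm, Matrix.mul_assoc, mem_unitaryGroup_iff'.1 hU,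
    Matrix.mul_one]

lemma isHermitian_smul_add_smul_conjTranspose {ι : Type*} (A : Matrix ι ι ℂ) (z : ℂ) :
    (z • A + star z • Aᴴ).IsHermitian := by
  simp [IsHermitian, add_comm]

lemma trace_mul_smul_add_smul_conjTranspose {ι : Type*} [Fintype ι] {M : Matrix ι ι ℂ}
    (hM : M.IsHermitian) (A : Matrix ι ι ℂ) (z : ℂ) :
    trace (M * (z • A + star z • Aᴴ)) = ((2 * (z * trace (M * A)).re : ℝ) : ℂ) := by
  have h : trace (M * Aᴴ) = star (trace (M * A)) := by
    rw [← trace_conjTranspose, conjTranspose_mul, hM.eq, Matrix.trace_mul_comm]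
  have h' := Complex.add_conj (z * trace (M * A))
  rw [mul_add, trace_add, mul_smul_comm, mul_smul_comm, trace_smul, trace_smul, h, ← h']
  simp

/-- If every `W_c(A)` is a disc centred at `0`, the norm of `zA + (zA)ᴴ` is attained by pairing a
unitary conjugate of it with `wA + (wA)ᴴ`, for any `w` on the unit circle. -/
lemma exists_unitary_trace_conj_mul_eq {n : ℕ} {A : Matrix (Fin n) (Fin n) ℂ}
    (h : ∀ c : Fin n → ℝ, IsCircularDiscAtZero (cNumericalRange c A)) {z w : ℂ}
    (hz : ‖z‖ = 1) (hw : ‖w‖ = 1) :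
    ∃ U ∈ unitaryGroup (Fin n) ℂ,
      trace (U * (z • A + star z • Aᴴ) * star U * (w • A + star w • Aᴴ)) =
        trace ((z • A + star z • Aᴴ) * (z • A + star z • Aᴴ)) := by
  set H := z • A + star z • Aᴴ with hHdef
  have hH : H.IsHermitian := isHermitian_smul_add_smul_conjTranspose A z
  set U : Matrix (Fin n) (Fin n) ℂ := hH.eigenvectorUnitary.1
  have hU : U ∈ unitaryGroup (Fin n) ℂ := hH.eigenvectorUnitary.2
  set D : Matrix (Fin n) (Fin n) ℂ := diagonal fun j => (hH.eigenvalues j : ℂ) with hD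
  have hspec : H = U * D * star U := by
    have := hH.spectral_theorem
    rw [Unitary.conjStarAlgAut_apply] at this
    exact this
  have hDspec : star U * H * U = D := by
    have hUU := mem_unitaryGroup_iff'.1 hU
    calc star U * H * U = (star U * U) * D * (star U * U) := by
          rw [hspec]; simp only [Matrix.mul_assoc]
      _ = D := by rw [hUU, Matrix.one_mul, Matrix.mul_one]
  obtain ⟨r, -, hr⟩ := h hH.eigenvalues
  set s : ℝ := 2 * (z * trace (H * A)).re with hs
  have hHH : trace (H * H) = (s : ℂ) := by
    conv_lhs => rw [hHdef]
    exact trace_mul_smul_add_smul_conjTranspose hH A z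
  have hs0 : 0 ≤ s := by
    have := (posSemidef_conjTranspose_mul_self H).trace_nonneg
    rw [hH.eq, hHH] at this
    exact_mod_cast this
  have hmem : trace (H * A) ∈ cNumericalRange hH.eigenvalues A := by
    refine (mem_cNumericalRange_iff _ _ _).2 ⟨U, hU, ?_⟩
    rw [← hD]
    conv_lhs => rw [hspec]
    rw [Matrix.mul_assoc, Matrix.mul_assoc, Matrix.trace_mul_comm]
    simp only [Matrix.mul_assoc]
  have hsr : s / 2 ≤ r := by
    rw [hr, mem_closedBall_zero_iff] at hmem
    calc s / 2 = (z * trace (H * A)).re := by rw [hs]; ring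
      _ ≤ ‖z * trace (H * A)‖ := Complex.re_le_norm _
      _ = ‖trace (H * A)‖ := by rw [norm_mul, hz, one_mul]
      _ ≤ r := hmem
  -- This point is chosen so that multiplying by `w` gives `s / 2`, and doubling the real part
  -- recovers `s = tr (H²)`.
  have hmem' : star w * ((s / 2 : ℝ) : ℂ) ∈ cNumericalRange hH.eigenvalues A := by
    rw [hr, mem_closedBall_zero_iff, norm_mul, norm_star, hw, one_mul, Complex.norm_real,
      Real.norm_of_nonneg (by positivity)]
    exact hsr
  obtain ⟨V, hV, hVs⟩ := (mem_cNumericalRange_iff _ _ _).1 hmem'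
  rw [← hD] at hVs
  refine ⟨V * star U, mul_mem hV (Unitary.star_mem hU), ?_⟩
  have hM : V * star U * H * star (V * star U) = V * D * star V := by
    rw [star_mul, star_star, ← hDspec]
    simp only [Matrix.mul_assoc]
  have hMA : trace (V * D * star V * A) = star w * ((s / 2 : ℝ) : ℂ) := by
    rw [hVs, Matrix.mul_assoc, Matrix.mul_assoc, Matrix.trace_mul_comm]
    simp only [Matrix.mul_assoc]
  have hMH : (V * D * star V).IsHermitian := by
    rw [← hM]
    exact isHermitian_mul_mul_conjTranspose _ hH
  have hww : w * star w = 1 := by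
    have := Complex.mul_conj' w
    rw [hw] at this
    simpa using this
  rw [hM, trace_mul_smul_add_smul_conjTranspose hMH, hMA, hHH, ← mul_assoc, hww, one_mul,
    Complex.ofReal_re]
  congr 1
  ring

/-- If the characteristic polynomial of `zA + z̄B` is the same for all `z` on the unit circle, then
that of `A` is a power of the indeterminate. -/
lemma charpoly_eq_X_pow_of_charpoly_const {ι : Type*} [Fintype ι] [DecidableEq ι]
    {A B : Matrix ι ι ℂ} {p : ℂ[X]}
    (h : ∀ z : ℂ, ‖z‖ = 1 → (z • A + star z • B).charpoly = p) :
    A.charpoly = X ^ Fintype.card ι := by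
  set N := Fintype.card ι
  have hdeg : p.natDegree = N := by
    rw [← h 1 (by simp), charpoly_natDegree_eq_dim]
  have hmonic : p.Monic := by
    rw [← h 1 (by simp)]
    exact charpoly_monic _
  refine Polynomial.funext fun s => ?_
  -- On the unit circle, the hypothesis at `z = w̄`, evaluated at `s * w̄` and multiplied by `w ^
  -- N`, contains no conjugates: it reads `L(w) = R(w)`.
  let L : ℂ[X] := det (scalar ι (C s) - A.map C - (X ^ 2 : ℂ[X]) • B.map C)
  let R : ℂ[X] := ∑ k ∈ Finset.range (N + 1), C (p.coeff k * s ^ k) * X ^ (N - k)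
  have hL (w : ℂ) : L.eval w = det (scalar ι s - A - w ^ 2 • B) := by
    change evalRingHom w L = _
    rw [RingHom.map_det (evalRingHom w)]
    congr 1
    ext i j
    by_cases hij : i = j <;> simp [hij] <;> ring
  have hR (w : ℂ) : R.eval w = ∑ k ∈ Finset.range (N + 1), p.coeff k * s ^ k * w ^ (N - k) := by
    simp [R, eval_finsetSum]
  have hLR : L = R := by
    refine eq_of_infinite_eval_eq L R (Set.Infinite.mono (s := Metric.sphere (0 : ℂ) 1) ?_ ?_)
    · intro w hw
      rw [mem_sphere_zero_iff_norm] at hw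
      have hww : w * star w = 1 := by
        have := Complex.mul_conj' w
        rw [hw] at this
        simpa using this
      have hp := congrArg (eval (s * star w)) (h (star w) (by rw [norm_star, hw]))
      rw [eval_charpoly, star_star] at hp
      have hmat : scalar ι s - A - w ^ 2 • B =
          w • (scalar ι (s * star w) - (star w • A + w • B)) := by
        rw [smul_sub, smul_add, smul_smul, smul_smul, hww, one_smul, ← sub_sub, sq]
        congr 2
        ext i j
        by_cases hij : i = j
        · simp only [hij, scalar_apply, diagonal_apply_eq, Matrix.smul_apply, smul_eq_mul]
          linear_combination -s * hww
        · simp [hij]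
      change L.eval w = R.eval w
      rw [hL, hR, hmat, det_smul, hp, eval_eq_sum_range, hdeg, Finset.mul_sum]
      refine Finset.sum_congr rfl fun k hk => ?_
      have hkN : k ≤ N := Nat.lt_succ_iff.1 (Finset.mem_range.1 hk)
      have : w ^ N = w ^ (N - k) * w ^ k := by rw [← pow_add, Nat.sub_add_cancel hkN]
      have hpow : w ^ k * star w ^ k = 1 := by rw [← mul_pow, hww, one_pow]
      change w ^ N * _ = _
      rw [this, mul_pow]
      linear_combination (p.coeff k * s ^ k * w ^ (N - k)) * hpow
    · exact (isPreconnected_sphere (by simp [Complex.rank_real_complex])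
        (0 : ℂ) 1).infinite_of_nontrivial
        ⟨1, by simp, -1, by simp, by norm_num⟩
  -- At `w = 0` the matrix `B` disappears from `L`, and only the leading term `k = N` of `R`
  -- survives.
  have h0 := congrArg (eval 0) hLR
  rw [hL, hR, Finset.sum_range_succ, Finset.sum_eq_zero, ← hdeg, hmonic.coeff_natDegree] at h0
  · rw [eval_charpoly]
    simpa [hdeg] using h0
  · intro k hk
    rw [zero_pow (Nat.sub_ne_zero_of_lt (Finset.mem_range.1 hk)), mul_zero]

theorem mainTheorem9 (n : ℕ) (A : Matrix (Fin n) (Fin n) ℂ)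
    (h : ∀ c : Fin n → ℝ, IsCircularDiscAtZero (cNumericalRange c A)) :
    IsNilpotent A := by
  have hconst (z : ℂ) (hz : ‖z‖ = 1) :
      (z • A + star z • Aᴴ).charpoly = ((1 : ℂ) • A + star (1 : ℂ) • Aᴴ).charpoly := by
    have h1 : ‖(1 : ℂ)‖ = 1 := norm_one
    obtain ⟨U, hU, hUz⟩ := exists_unitary_trace_conj_mul_eq h hz h1
    obtain ⟨V, hV, hVz⟩ := exists_unitary_trace_conj_mul_eq h h1 hz
    exact charpoly_eq_of_trace_conj_mul_eq (isHermitian_smul_add_smul_conjTranspose A z)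
      (isHermitian_smul_add_smul_conjTranspose A 1) hU hV hUz hVz
  refine ⟨Fintype.card (Fin n), ?_⟩
  have hA := aeval_self_charpoly A
  rwa [charpoly_eq_X_pow_of_charpoly_const hconst, aeval_X_pow] at hA
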